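/- Let $d\ge 1$ be an integer, let $R$ be a commutative artinian ring and let $\Lambda$ be an Artin $R$-algebra, i.e. an $R$-algebra that is finitely generated as an $R$-module. Let $\operatorname{mod}\Lambda$ be the category of right $\Lambda$-modules of finite length. A subcategory of $\operatorname{mod}\Lambda$ is understood to be full and closed under (finite) direct sums and direct summands. A subcategory $\mathcal M$ is functorially finite if for every $Y\in\operatorname{mod}\Lambda$ there are a morphism $X\to Y$ with $X\in\mathcal M$ through which every morphism $X'\to Y$ with $X'\in\mathcal M$ factors, and a morphism $Y\to Z$ with $Z\in\mathcal M$ through which every morphism $Y\to Z'$ with $Z'\in\mathcal M$ factors. Let $\mathcal M$ be a $d$-cluster-tilting subcategory of $\operatorname{mod}\Lambda$, that is, a functorially finite subcategory such that \begin{align*} \mathcal M&=\{X\in\operatorname{mod}\Lambda : \operatorname{Ext}^k_\Lambda(X,M)=0\text{ for all }M\in\mathcal M,\ 1\le k\le d-1\}\\ &=\{Y\in\operatorname{mod}\Lambda : \operatorname{Ext}^k_\Lambda(M,Y)=0\text{ for all }M\in\mathcal M,\ 1\le k\le d-1\}. \end{align*} Then for every indecomposable object $N\in\mathcal M$ there exist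 $M\in\mathcal M$ and a morphism $g\colon M\to N$ which is right almost split in $\mathcal M$: $g$ is not a split epimorphism, and every morphism $L\to N$ with $L\in\mathcal M$ which is not a split epimorphism factors through $g$. -/

import Mathlib

open CategoryTheory CategoryTheory.Limits

universe u v

section Subcategories

variable {C : Type u} [Category.{v} C]

/-- `f : X ⟶ Y` is a right `𝓧`-approximation of `Y`: the object `X` lies in `𝓧` and every morphism
from an object of `𝓧` to `Y` factors through `f`. -/
def IsRightApproximation (𝓧 : ObjectProperty C) {X Y : C} (f : X ⟶ Y) : Prop :=
  𝓧 X ∧ ∀ (X' : C), 𝓧 X' → ∀ h : X' ⟶ Y, ∃ t : X' ⟶ X, t ≫ f = h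

/-- `f : Y ⟶ X` is a left `𝓧`-approximation of `Y`: the object `X` lies in `𝓧` and every morphism
from `Y` to an object of `𝓧` factors through `f`. -/
def IsLeftApproximation (𝓧 : ObjectProperty C) {Y X : C} (f : Y ⟶ X) : Prop :=
  𝓧 X ∧ ∀ (X' : C), 𝓧 X' → ∀ h : Y ⟶ X', ∃ t : X ⟶ X', f ≫ t = h

/-- `g : M ⟶ N` is a right almost split morphism in the full subcategory `𝓧`. -/
structure IsRightAlmostSplit (𝓧 : ObjectProperty C) {M N : C} (g : M ⟶ N) : Prop where
  source_mem : 𝓧 M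
  target_mem : 𝓧 N
  not_isSplitEpi : ¬ IsSplitEpi g
  factors : ∀ (L : C), 𝓧 L → ∀ h : L ⟶ N, ¬ IsSplitEpi h → ∃ t : L ⟶ M, t ≫ g = h

end Subcategories

section Modules

variable (Λ : Type u) [Ring Λ]

/-- The category of right `Λ`-modules, that is, of left modules over the opposite ring. -/
abbrev RightMod : Type (u + 1) := ModuleCat.{u} Λᵐᵒᵖ

/-- The full subcategory `mod Λ` of right `Λ`-modules of finite length. -/
def finMod : ObjectProperty (RightMod Λ) := fun X => IsFiniteLength Λᵐᵒᵖ X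

variable {Λ}

/-- A subcategory of `mod Λ`: full, closed under finite direct sums (including the empty one)
and under direct summands (hence under isomorphisms). -/
structure IsAdditiveSubcategory (𝓜 : ObjectProperty (RightMod Λ)) : Prop where
  le_finMod : 𝓜 ≤ finMod Λ
  directSums : 𝓜.IsClosedUnderFiniteCoproducts
  directSummands : 𝓜.IsStableUnderRetracts

/-- A functorially finite subcategory of `mod Λ`: every module in `mod Λ` has a right and
a left `𝓜`-approximation. -/
structure IsFunctoriallyFinite (𝓜 : ObjectProperty (RightMod Λ)) : Prop
    extends IsAdditiveSubcategory 𝓜 where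
  contravariantlyFinite : ∀ Y : RightMod Λ, finMod Λ Y →
    ∃ (X : RightMod Λ) (f : X ⟶ Y), IsRightApproximation 𝓜 f
  covariantlyFinite : ∀ Y : RightMod Λ, finMod Λ Y →
    ∃ (X : RightMod Λ) (f : Y ⟶ X), IsLeftApproximation 𝓜 f

/-- A `d`-cluster-tilting subcategory of `mod Λ`. -/
structure IsClusterTilting (d : ℕ) (𝓜 : ObjectProperty (RightMod Λ)) : Prop
    extends IsFunctoriallyFinite 𝓜 where
  mem_iff_ext_left : ∀ X : RightMod Λ, 𝓜 X ↔
    finMod Λ X ∧ ∀ k : ℕ, 1 ≤ k → k < d → ∀ M : RightMod Λ, 𝓜 M →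
      Subsingleton (Abelian.Ext X M k)
  mem_iff_ext_right : ∀ Y : RightMod Λ, 𝓜 Y ↔
    finMod Λ Y ∧ ∀ k : ℕ, 1 ≤ k → k < d → ∀ M : RightMod Λ, 𝓜 M →
      Subsingleton (Abelian.Ext M Y k)

end Modules

/-! Right almost split morphisms descend along approximations: if `p : E ⟶ N` is right almost split
in `mod Λ` and `f : M ⟶ E` is a right `𝓜`-approximation, then `f ≫ p` is right almost split in `𝓜`.
The work is to produce `p`. Non-invertible endomorphisms of `N` form a proper `R`-submodule of `End
N` (Fitting), so some nonzero functional `φ : End N → I` kills them, with `I` the injective hull of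
a simple `R`-module. A map `h : L → N` is not split epi iff no `h ∘ s` is invertible, and then `φ (h
∘ s) = 0` for all `s : N → L`. `LinearMap.exists_factors_iff_forall_eq_zero` builds `p` through
which exactly the `h` with this vanishing factor; the identity does not, as `φ ≠ 0`. This is the
Auslander–Reiten formula made explicit: the kernel of `p` is `Hom_R(Tr N, I)`, for the transpose `Tr
N` of the chosen presentation. `E` has finite length because `Hom_R(A, I)` does. -/

section InjectiveHull

/-! ### Injective hulls -/

/-- Every submodule `S` of an injective module `Q` has a maximal essential extension `I` inside
`Q`, and `I` is injective. -/
theorem Submodule.exists_injective_essential_extension {R Q : Type u} [Ring R] [AddCommGroup Q]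
    [Module R Q] [Module.Injective R Q] (S : Submodule R Q) :
    ∃ I : Submodule R Q, S ≤ I ∧ (∀ T ≤ I, Disjoint T S → T = ⊥) ∧ Module.Injective R I := by
  obtain ⟨I, hSI, hI⟩ := zorn_le_nonempty₀
    {I : Submodule R Q | S ≤ I ∧ ∀ T ≤ I, Disjoint T S → T = ⊥} (by
      intro c hc hchain J hJ
      refine ⟨sSup c, ⟨(hc hJ).1.trans (le_sSup hJ), fun T hT hTS ↦ ?_⟩, fun _ ↦ le_sSup⟩
      rw [eq_bot_iff]
      intro x hx
      obtain ⟨K, hK, hxK⟩ := (Submodule.mem_sSup_of_directed ⟨J, hJ⟩ hchain.directedOn).1 (hT hx)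
      have := (hc hK).2 (R ∙ x) ((Submodule.span_singleton_le_iff_mem _ _).2 hxK)
        (hTS.mono_left ((Submodule.span_singleton_le_iff_mem _ _).2 hx))
      simpa using this) S ⟨le_rfl, fun T hT hTS ↦ by simpa using hTS.mono_right hT⟩
  -- For `K` maximal among submodules meeting `I` trivially, `I` embeds in `Q ⧸ K`, and its
  -- inclusion into `Q` extends to `e : Q ⧸ K → Q`. The range of `e` is again essential over `S`, so
  -- it equals `I`, and `e ∘ K.mkQ` retracts `Q` onto `I`.
  obtain ⟨K, -, hK⟩ := zorn_le_nonempty₀ {K : Submodule R Q | Disjoint K I} (by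
      intro c hc hchain J hJ
      exact ⟨sSup c, (hchain.directedOn.disjoint_sSup_left).2 fun K hK ↦ hc hK,
        fun _ ↦ le_sSup⟩) ⊥ disjoint_bot_left
  have hinj : Function.Injective (K.mkQ ∘ₗ I.subtype) := by
    rw [← LinearMap.ker_eq_bot, LinearMap.ker_comp, K.ker_mkQ, ← Submodule.disjoint_iff_comap_eq_bot]
    exact hK.prop.symm
  obtain ⟨e, he⟩ := Module.Injective.out (K.mkQ ∘ₗ I.subtype) hinj I.subtype
  have hrange : LinearMap.range e = I := by
    refine (hI.eq_of_le ⟨?_, fun T hT hTS ↦ ?_⟩ ?_).symm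
    · exact fun x hx ↦ ⟨_, he ⟨x, hSI hx⟩⟩
    · have hTI : T ⊓ I = ⊥ := hI.prop.2 _ inf_le_right (hTS.mono_left inf_le_left)
      -- The preimage of `T` contains `K` and still meets `I` trivially, so maximality of `K`
      -- applies.
      have hle : (T.comap e).comap K.mkQ ≤ K := by
        refine hK.le_of_ge ?_ fun x hx ↦ ?_
        · rw [Set.mem_ofPred_eq, Submodule.disjoint_def]
          intro x hxT hxI
          have hx : e (K.mkQ x) = x := he ⟨x, hxI⟩
          have : x ∈ T ⊓ I := ⟨hx ▸ (hxT : e (K.mkQ x) ∈ T), hxI⟩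
          simpa [hTI] using this
        · have : K.mkQ x = 0 := by simpa using hx
          simp [this]
      rw [eq_bot_iff]
      intro t ht
      obtain ⟨q, rfl⟩ := hT ht
      obtain ⟨q, rfl⟩ := K.mkQ_surjective q
      have : K.mkQ q = 0 := by simpa using hle ht
      simp [this]
    · exact fun x hx ↦ ⟨_, he ⟨x, hx⟩⟩
  refine ⟨I, hSI, hI.prop.2, ⟨fun X Y _ _ _ _ f hf g ↦ ?_⟩⟩
  obtain ⟨h, hh⟩ := Module.Injective.out f hf (I.subtype ∘ₗ g)
  refine ⟨(e ∘ₗ K.mkQ ∘ₗ h).codRestrict I fun y ↦ hrange ▸ ⟨_, rfl⟩, fun x ↦ ?_⟩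
  ext
  have := he (g x)
  simpa [hh] using this

/-- Every module has an injective hull. -/
theorem Module.exists_injective_hull (R S : Type u) [Ring R] [AddCommGroup S] [Module R S] :
    ∃ (I : ModuleCat.{u} R) (i : S →ₗ[R] I), Module.Injective R I ∧ Function.Injective i ∧
      ∀ T : Submodule R I, Disjoint T (LinearMap.range i) → T = ⊥ := by
  let Q := Injective.under (ModuleCat.of R S)
  have : CategoryTheory.Injective (ModuleCat.of R Q) :=
    inferInstanceAs (CategoryTheory.Injective (Injective.under (ModuleCat.of R S)))
  have : Module.Injective R Q := Module.injective_module_of_injective_object R Q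
  let j : S →ₗ[R] Q := (Injective.ι (ModuleCat.of R S)).hom
  have hj : Function.Injective j := (ModuleCat.mono_iff_injective _).1 inferInstance
  obtain ⟨I, hSI, hess, hI⟩ := (LinearMap.range j).exists_injective_essential_extension
  refine ⟨ModuleCat.of R I, j.codRestrict I fun x ↦ hSI ⟨x, rfl⟩, hI,
    fun x y h ↦ hj (congrArg Subtype.val h), fun T hT ↦ ?_⟩
  have := hess (T.map I.subtype) (Submodule.map_subtype_le _ _) (by
    rw [Submodule.disjoint_def]
    rintro _ ⟨t, ht, rfl⟩ ⟨s, hs⟩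
    have := Submodule.disjoint_def.1 hT t ht ⟨s, Subtype.ext hs⟩
    simp [this])
  rw [← Submodule.map_bot I.subtype] at this
  exact Submodule.map_injective_of_injective I.injective_subtype this

end InjectiveHull

/-! ### Finite length of Hom into the hull of a simple module -/

section Duality

variable {R : Type*} [CommRing R] {S I : Type*} [AddCommGroup S] [Module R S]
  [AddCommGroup I] [Module R I]

/-- A map from a simple module to an essential extension of a simple module `S` takes values
in `S`. -/
theorem LinearMap.range_le_of_isSimpleModule_of_essential {T : Type*} [AddCommGroup T] [Module R T]
    [IsSimpleModule R T] (i : S →ₗ[R] I)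
    (hi : ∀ T : Submodule R I, Disjoint T (LinearMap.range i) → T = ⊥) (f : T →ₗ[R] I) :
    LinearMap.range f ≤ LinearMap.range i := by
  rcases eq_bot_or_eq_top ((LinearMap.range i).comap f) with h | h
  · have : LinearMap.range f = ⊥ := hi _ (by
      rw [Submodule.disjoint_def]
      rintro _ ⟨t, rfl⟩ ht
      have : t ∈ (LinearMap.range i).comap f := ht
      rw [h, Submodule.mem_bot] at this
      simp [this])
    simp [this]
  · rintro _ ⟨t, rfl⟩
    have : t ∈ (LinearMap.range i).comap f := h ▸ Submodule.mem_top
    exact this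

/-- Homomorphisms from a module of finite length to an essential extension of a simple module
form a module of finite length. -/
theorem IsFiniteLength.linearMap_of_essential [IsSimpleModule R S] (i : S →ₗ[R] I) (hinj : Function.Injective i)
    (hi : ∀ T : Submodule R I, Disjoint T (LinearMap.range i) → T = ⊥)
    {M : Type*} [AddCommGroup M] [Module R M] (hM : IsFiniteLength R M) :
    IsFiniteLength R (M →ₗ[R] I) := by
  induction hM with
  | of_subsingleton => exact .of_subsingleton
  | @of_simple_quotient M _ _ N hN _ ih =>
    have hS : IsFiniteLength R (LinearMap.range i) :=
      (LinearEquiv.ofInjective i hinj).isFiniteLength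
        (isFiniteLength_iff_isNoetherian_isArtinian.2 ⟨inferInstance, inferInstance⟩)
    have := IsSimpleModule.nontrivial R (M ⧸ N)
    obtain ⟨t, ht⟩ := exists_ne (0 : M ⧸ N)
    have hQ : IsFiniteLength R ((M ⧸ N) →ₗ[R] I) := by
      -- Evaluation at a generator `t` of the simple quotient is injective, with values in the copy
      -- of `S`.
      refine hS.of_injective (f := (LinearMap.applyₗ t).codRestrict (LinearMap.range i)
        fun f ↦ LinearMap.range_le_of_isSimpleModule_of_essential i hi f ⟨t, rfl⟩) ?_
      intro f g hfg
      have hfg : f t = g t := congrArg Subtype.val hfg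
      have : R ∙ t ≤ LinearMap.eqLocus f g :=
        (Submodule.span_singleton_le_iff_mem _ _).2 hfg
      rw [IsSimpleModule.span_singleton_eq_top R ht, top_le_iff, LinearMap.eqLocus_eq_top] at this
      exact this
    obtain ⟨_, _⟩ := isFiniteLength_iff_isNoetherian_isArtinian.1 hQ
    obtain ⟨_, _⟩ := isFiniteLength_iff_isNoetherian_isArtinian.1 ih
    have hrange : LinearMap.range (LinearMap.lcomp R I N.mkQ) =
        LinearMap.ker (LinearMap.lcomp R I N.subtype) := by
      ext f
      constructor
      · rintro ⟨g, rfl⟩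
        ext x
        exact (congrArg g ((Submodule.Quotient.mk_eq_zero N).2 x.2)).trans (map_zero g)
      · intro hf
        refine ⟨N.liftQ f fun x hx ↦ LinearMap.congr_fun hf ⟨x, hx⟩, ?_⟩
        rfl
    exact isFiniteLength_iff_isNoetherian_isArtinian.2
      ⟨isNoetherian_of_range_eq_ker _ _ hrange, isArtinian_of_range_eq_ker _ _ hrange⟩

end Duality

/-! ### Fitting's lemma and the non-invertible endomorphisms -/

section Fitting

variable {A N : Type*} [Ring A] [AddCommGroup N] [Module A N] [IsNoetherian A N] [IsArtinian A N]

/-- Fitting's lemma: an endomorphism of an indecomposable module of finite length is either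
invertible or nilpotent. -/
theorem Module.End.isUnit_or_isNilpotent
    (hN : ∀ p q : Submodule A N, IsCompl p q → p = ⊥ ∨ q = ⊥) (f : Module.End A N) :
    IsUnit f ∨ IsNilpotent f := by
  obtain ⟨n, hn, hn0⟩ :=
    (f.eventually_isCompl_ker_pow_range_pow.and (Filter.eventually_gt_atTop 0)).exists
  rcases hN _ _ hn with h | h
  · left
    rw [← isUnit_pow_iff hn0.ne', Module.End.isUnit_iff]
    refine ⟨LinearMap.ker_eq_bot.1 h, LinearMap.range_eq_top.1 ?_⟩
    simpa [h] using hn.sup_eq_top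
  · exact .inr ⟨n, LinearMap.range_eq_bot.1 h⟩

/-- The non-invertible endomorphisms of an indecomposable module of finite length. -/
def Module.End.nonunitsSubmodule (R : Type*) [CommRing R] [Algebra R A] [Module R N]
    [IsScalarTower R A N] [Nontrivial N] (hN : ∀ p q : Submodule A N, IsCompl p q → p = ⊥ ∨ q = ⊥) :
    Submodule R (Module.End A N) where
  carrier := nonunits (Module.End A N)
  zero_mem' := not_isUnit_zero
  add_mem' := by
    -- If `f + g = w` is invertible, then `w⁻¹ f` is nilpotent, hence `w⁻¹ g = 1 - w⁻¹ f` is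
    -- invertible.
    rintro f g hf hg ⟨w, hw⟩
    have hf' : ¬ IsUnit (↑w⁻¹ * f) := fun h ↦ hf (by simpa using h)
    have hnil := (Module.End.isUnit_or_isNilpotent hN _).resolve_left hf'
    have : ↑w⁻¹ * g = 1 - ↑w⁻¹ * f := by
      rw [eq_sub_iff_add_eq, ← mul_add, add_comm g f, ← hw, Units.inv_mul]
    have hg' := hnil.isUnit_one_sub
    rw [← this] at hg'
    exact hg (by simpa using hg')
  smul_mem' := by
    rintro r f hf ⟨w, hw⟩
    refine hf ⟨⟨f, r • ↑w⁻¹, ?_, ?_⟩, rfl⟩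
    · ext x
      have : (↑w * ↑w⁻¹ : Module.End A N) x = x := by simp
      rw [hw] at this
      exact (LinearMap.map_smul_of_tower f r _).trans this
    · ext x
      have : (↑w⁻¹ * ↑w : Module.End A N) x = x := by simp
      rw [hw] at this
      exact (LinearMap.map_smul_of_tower (↑w⁻¹ : Module.End A N) r (f x)).symm.trans this

end Fitting

/-! ### Coinduction from `R` to `A` -/

section CoinducedModule

variable (R A I : Type*) [CommRing R] [Ring A] [Algebra R A] [AddCommGroup I] [Module R I]

/-- The left `A`-module of `R`-linear maps from the right `A`-module `A` to `I`. -/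
def CoinducedModule : Type _ := A →ₗ[R] I

namespace CoinducedModule

instance : AddCommGroup (CoinducedModule R A I) := inferInstanceAs (AddCommGroup (A →ₗ[R] I))

instance : Module R (CoinducedModule R A I) := inferInstanceAs (Module R (A →ₗ[R] I))

variable {R A I}

/-- The underlying linear map of an element of the coinduced module. -/
def toLinearMap : CoinducedModule R A I ≃ₗ[R] (A →ₗ[R] I) := LinearEquiv.refl R _

/-- Right multiplication in the argument gives a left action: `a • b • F` sends `x` to `F (x * a *
b)`. -/
instance : SMul A (CoinducedModule R A I) where
  smul a F := toLinearMap.symm (toLinearMap F ∘ₗ LinearMap.mulRight R a)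

theorem toLinearMap_smul (a x : A) (F : CoinducedModule R A I) :
    toLinearMap (a • F) x = toLinearMap F (x * a) := rfl

@[ext]
theorem ext {F G : CoinducedModule R A I} (h : ∀ x, toLinearMap F x = toLinearMap G x) : F = G :=
  toLinearMap.injective (LinearMap.ext h)

instance : Module A (CoinducedModule R A I) where
  one_smul F := by ext; simp [toLinearMap_smul]
  mul_smul a b F := by ext; simp [toLinearMap_smul, mul_assoc]
  smul_zero a := by ext; simp [toLinearMap_smul]
  smul_add a F G := by ext; simp [toLinearMap_smul]
  add_smul a b F := by ext; simp [toLinearMap_smul, mul_add]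
  zero_smul F := by ext; simp [toLinearMap_smul]

instance : IsScalarTower R A (CoinducedModule R A I) where
  smul_assoc r a F := by ext; simp [toLinearMap_smul]

/-- The `A`-linear map into the coinduced module given by a functional. -/
def lift {L : Type*} [AddCommGroup L] [Module R L] [Module A L] [IsScalarTower R A L]
    (θ : L →ₗ[R] I) : L →ₗ[A] CoinducedModule R A I where
  toFun l := toLinearMap.symm (θ ∘ₗ (LinearMap.toSpanSingleton A L l).restrictScalars R)
  map_add' l l' := by ext; simp
  map_smul' a l := by ext; simp [toLinearMap_smul, mul_smul]

theorem toLinearMap_lift {L : Type*} [AddCommGroup L] [Module R L] [Module A L]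
    [IsScalarTower R A L] (θ : L →ₗ[R] I) (l : L) (a : A) :
    toLinearMap (lift θ l) a = θ (a • l) := rfl

/-- Precomposition with left multiplication by `r`. -/
def precomp (r : A) : CoinducedModule R A I →ₗ[A] CoinducedModule R A I where
  toFun F := toLinearMap.symm (toLinearMap F ∘ₗ LinearMap.mulLeft R r)
  map_add' F G := by ext; simp
  map_smul' a F := by ext; simp [toLinearMap_smul, mul_assoc]

theorem toLinearMap_precomp (r a : A) (F : CoinducedModule R A I) :
    toLinearMap (precomp r F) a = toLinearMap F (r * a) := rfl

end CoinducedModule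

end CoinducedModule

/-! ### Morphisms to `N` determined by a functional on `End N` -/

section AlmostSplit

/-- Given relations `r` presenting a module `N` by generators `n`, a family `l` satisfying these
relations defines a linear map on `N`. -/
theorem LinearMap.exists_of_relations {A N L κ μ : Type*} [Ring A] [AddCommGroup N] [Module A N]
    [AddCommGroup L] [Module A L] [Fintype κ] {n : κ → N} (hn : Submodule.span A (Set.range n) = ⊤)
    {r : μ → κ → A}
    (hr : Submodule.span A (Set.range r) = LinearMap.ker (Fintype.linearCombination A n))
    (l : κ → L) (hl : ∀ j, ∑ i, r j i • l i = 0) : ∃ s : N →ₗ[A] L, ∀ i, s (n i) = l i := by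
  classical
  have hsurj : Function.Surjective (Fintype.linearCombination A n) := by
    rw [← LinearMap.range_eq_top, Fintype.range_linearCombination, hn]
  have hker : LinearMap.ker (Fintype.linearCombination A n) ≤
      LinearMap.ker (Fintype.linearCombination A l) := by
    rw [← hr, Submodule.span_le]
    rintro _ ⟨j, rfl⟩
    simpa [Fintype.linearCombination_apply] using hl j
  refine ⟨(LinearMap.ker _).liftQ _ hker ∘ₗ
    (LinearMap.quotKerEquivOfSurjective _ hsurj).symm.toLinearMap, fun i ↦ ?_⟩
  have : (LinearMap.quotKerEquivOfSurjective _ hsurj).symm (n i) =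
      Submodule.Quotient.mk (Pi.single i 1) := by
    rw [LinearEquiv.symm_apply_eq, LinearMap.quotKerEquivOfSurjective_apply_mk]
    simp
  rw [LinearMap.comp_apply, LinearEquiv.coe_coe, this]
  refine (Submodule.liftQ_apply _ _ _).trans ?_
  simp

variable {R A N I : Type u} [CommRing R] [Ring A] [Algebra R A]
  [AddCommGroup N] [Module R N] [Module A N] [IsScalarTower R A N]
  [AddCommGroup I] [Module R I] [Module.Injective R I]

/-- For a finitely presented module `N` and a functional `φ` on its endomorphism ring there is a
morphism `p` to `N` through which exactly those `h` factor for which `φ` kills all `h ∘ s`. -/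
theorem LinearMap.exists_factors_iff_forall_eq_zero {κ μ : Type} [Fintype κ] [Fintype μ]
    {n : κ → N} (hn : Submodule.span A (Set.range n) = ⊤) {r : μ → κ → A}
    (hr : Submodule.span A (Set.range r) = LinearMap.ker (Fintype.linearCombination A n))
    (φ : Module.End A N →ₗ[R] I) :
    ∃ (E : Submodule A (N × (μ → CoinducedModule R A I))) (p : E →ₗ[A] N),
      ∀ (L : Type u) [AddCommGroup L] [Module A L] (h : L →ₗ[A] N),
        (∃ t, p ∘ₗ t = h) ↔ ∀ s : N →ₗ[A] L, φ (h ∘ₗ s) = 0 := by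
  classical
  -- Endomorphisms are determined on generators, so injectivity of `I` extends `φ` to a functional
  -- `ψ` on `N^κ`.
  let ev : Module.End A N →ₗ[R] (κ → N) :=
    { toFun := fun f i ↦ f (n i), map_add' := fun _ _ ↦ rfl, map_smul' := fun _ _ ↦ rfl }
  have hev : Function.Injective ev := fun f g hfg ↦
    LinearMap.ext_on_range hn fun i ↦ congrFun hfg i
  obtain ⟨ψ, hψ⟩ := Module.Injective.out ev hev φ
  let ψ' (i : κ) : N →ₗ[R] I := ψ ∘ₗ LinearMap.single R (fun _ ↦ N) i
  have hψ' (x : κ → N) : ψ x = ∑ i, ψ' i (x i) := by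
    rw [← LinearMap.sum_single_apply (fun _ : κ ↦ N) x, map_sum]
    simp [ψ']
  -- With `D = Hom_R(A, I)`, `E` is the pullback of `N → D^κ`, coinduced from `ψ`, and `D^μ → D^κ`,
  -- the Nakayama-type dual of the presentation `A^μ → A^κ`.
  let a : N × (μ → CoinducedModule R A I) →ₗ[A] (κ → CoinducedModule R A I) :=
    LinearMap.pi (fun i ↦ CoinducedModule.lift (ψ' i)) ∘ₗ LinearMap.fst A _ _
  let b : N × (μ → CoinducedModule R A I) →ₗ[A] (κ → CoinducedModule R A I) :=
    LinearMap.pi (fun i ↦ ∑ j, CoinducedModule.precomp (r j i) ∘ₗ LinearMap.proj j) ∘ₗ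
      LinearMap.snd A _ _
  have hab (x : N) (g : μ → CoinducedModule R A I) : a (x, g) = b (x, g) ↔
      ∀ i c, ψ' i (c • x) = ∑ j, CoinducedModule.toLinearMap (g j) (r j i * c) := by
    simp only [funext_iff, CoinducedModule.ext_iff]
    refine forall_congr' fun i ↦ forall_congr' fun c ↦ ?_
    simp [a, b, CoinducedModule.toLinearMap_lift, CoinducedModule.toLinearMap_precomp]
  refine ⟨LinearMap.eqLocus a b, LinearMap.fst A _ _ ∘ₗ Submodule.subtype _, ?_⟩
  intro L _ _ h
  let _ : Module R L := Module.compHom L (algebraMap R A)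
  have : IsScalarTower R A L := ⟨fun c x l ↦ by
    rw [Algebra.smul_def, mul_smul]; rfl⟩
  constructor
  · rintro ⟨t, rfl⟩ s
    -- Evaluating the pullback equations at `1` turns `φ` into a sum over the relations; each term
    -- vanishes because `q` below is `A`-linear and the relations hold in `N`.
    have key (i : κ) := (hab _ _).1 (t (s (n i))).2 i 1
    simp only [one_smul, mul_one] at key
    rw [← hψ, hψ']
    refine (Finset.sum_congr rfl fun i _ ↦ key i).trans ?_
    rw [Finset.sum_comm]
    refine Finset.sum_eq_zero fun j _ ↦ ?_
    have h0 : ∑ i, r j i • n i = 0 := by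
      have : r j ∈ LinearMap.ker (Fintype.linearCombination A n) :=
        hr ▸ Submodule.subset_span ⟨j, rfl⟩
      simpa [Fintype.linearCombination_apply] using this
    let q : N →ₗ[A] CoinducedModule R A I :=
      LinearMap.proj j ∘ₗ LinearMap.snd A _ _ ∘ₗ Submodule.subtype _ ∘ₗ t ∘ₗ s
    have h1 : ∑ i, CoinducedModule.toLinearMap (r j i • q (n i)) 1 = 0 := by
      rw [← LinearMap.sum_apply, ← map_sum]
      simp only [← map_smul]
      rw [← map_sum, h0]
      simp
    simpa [CoinducedModule.toLinearMap_smul, q] using h1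
  · intro hφ
    -- The kernel of `ρ` is `Hom_A(N, L)`, where `η` becomes `s ↦ φ (h ∘ s) = 0`. So `η` factors
    -- through the image of `ρ` and extends to `θ` on `L^μ`, whose coinduced components lift `h` to
    -- `E`.
    let ρ : (κ → L) →ₗ[R] (μ → L) :=
      { toFun := fun l j ↦ ∑ i, r j i • l i
        map_add' := fun l l' ↦ by ext j; simp [Finset.sum_add_distrib]
        map_smul' := fun c l ↦ by
          ext j
          simp only [Pi.smul_apply, Finset.smul_sum, RingHom.id_apply]
          exact Finset.sum_congr rfl fun i _ ↦ smul_comm _ _ _ }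
    let η : (κ → L) →ₗ[R] I := ψ ∘ₗ (h.restrictScalars R).compLeft κ
    have hη : LinearMap.ker ρ ≤ LinearMap.ker η := by
      intro l hl
      obtain ⟨s, hs⟩ := LinearMap.exists_of_relations hn hr l fun j ↦ congrFun hl j
      have h1 := hψ (h ∘ₗ s)
      rw [hφ s] at h1
      rw [LinearMap.mem_ker, ← h1]
      refine congrArg ψ (funext fun i ↦ ?_)
      simp [ev, hs]
    obtain ⟨θ, hθ⟩ := Module.Injective.out ((LinearMap.ker ρ).liftQ ρ le_rfl)
      (by rw [← LinearMap.ker_eq_bot, Submodule.ker_liftQ_eq_bot]; exact le_rfl)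
      ((LinearMap.ker ρ).liftQ η hη)
    have hθ' (l : κ → L) : θ (ρ l) = ψ fun i ↦ h (l i) := hθ (Submodule.Quotient.mk l)
    let θ' (j : μ) : L →ₗ[R] I := θ ∘ₗ LinearMap.single R (fun _ ↦ L) j
    have hθ'' (x : μ → L) : θ x = ∑ j, θ' j (x j) := by
      rw [← LinearMap.sum_single_apply (fun _ : μ ↦ L) x, map_sum]
      simp [θ']
    let g : L →ₗ[A] (μ → CoinducedModule R A I) :=
      LinearMap.pi fun j ↦ CoinducedModule.lift (θ' j)
    refine ⟨(h.prod g).codRestrict _ fun l ↦ ?_, by ext; simp⟩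
    refine (hab (h l) (g l)).2 fun i c ↦ ?_
    -- The pullback equation at `(i, c)` is `θ ∘ ρ = η` on the vector with sole entry `c • l` at
    -- `i`.
    have h1 := hθ' (Pi.single i (c • l))
    rw [hθ''] at h1
    have h2 : (fun k ↦ h (Pi.single (M := fun _ ↦ L) i (c • l) k)) =
        Pi.single (M := fun _ ↦ N) i (c • h l) := by
      ext k
      rcases eq_or_ne k i with rfl | hk
      · simp
      · simp [hk]
    rw [h2] at h1
    refine h1.symm.trans (Finset.sum_congr rfl fun j _ ↦ ?_)
    have h3 : ρ (Pi.single i (c • l)) j = (r j i * c) • l := by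
      change ∑ k, r j k • (Pi.single (M := fun _ ↦ L) i (c • l) k) = _
      rw [Finset.sum_eq_single i]
      · simp [mul_smul]
      · intro k _ hk
        simp [hk]
      · simp
    rw [h3]
    rfl

end AlmostSplit

/-! ### Right almost split morphisms in `mod Λ` and in `𝓜` -/

section Existence

/-- A nonzero functional on the endomorphism ring which kills the non-invertible endomorphisms, with
values in an injective module `I` for which `Hom(-, I)` preserves finite length. -/
theorem Module.End.exists_functional_eq_zero_of_not_isUnit {R A N : Type u} [CommRing R]
    [IsArtinianRing R] [Ring A] [Algebra R A] [Module.Finite R A] [AddCommGroup N] [Module R N]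
    [Module A N] [IsScalarTower R A N] [IsNoetherian A N] [IsArtinian A N] [Nontrivial N]
    (hN : ∀ p q : Submodule A N, IsCompl p q → p = ⊥ ∨ q = ⊥) :
    ∃ (I : ModuleCat.{u} R) (φ : Module.End A N →ₗ[R] I), Module.Injective R I ∧
      IsFiniteLength R (A →ₗ[R] I) ∧ φ ≠ 0 ∧ ∀ f, ¬ IsUnit f → φ f = 0 := by
  have : Module.Finite R N := .trans A N
  have : IsNoetherian R (Module.End A N) :=
    isNoetherian_of_injective (LinearMap.restrictScalarsₗ R A N N R)
      (LinearMap.restrictScalars_injective R)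
  let J := Module.End.nonunitsSubmodule R hN
  have hJ1 : (1 : Module.End A N) ∉ J := fun h ↦ h isUnit_one
  -- `End N` is noetherian over `R`, so the proper submodule `J` lies in a maximal one; `φ` is the
  -- quotient map followed by the hull of the simple quotient.
  obtain ⟨W, hW, hJW⟩ := (eq_top_or_exists_le_coatom J).resolve_left
    fun h ↦ hJ1 (h ▸ Submodule.mem_top)
  have : IsSimpleModule R (Module.End A N ⧸ W) := isSimpleModule_iff_isCoatom.2 hW
  obtain ⟨I, i, hI, hi, hess⟩ := Module.exists_injective_hull R (Module.End A N ⧸ W)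
  have hA : IsFiniteLength R A :=
    isFiniteLength_iff_isNoetherian_isArtinian.2 ⟨inferInstance, inferInstance⟩
  refine ⟨I, i ∘ₗ W.mkQ, hI, hA.linearMap_of_essential i hi hess, fun h ↦ ?_, fun f hf ↦ ?_⟩
  · refine hW.1 (eq_top_iff.2 fun f _ ↦ ?_)
    rw [← Submodule.Quotient.mk_eq_zero]
    exact hi ((LinearMap.congr_fun h f).trans (map_zero i).symm)
  · have : W.mkQ f = 0 := (Submodule.Quotient.mk_eq_zero W).2 (hJW hf)
    simp [this]

/-- Over an Artin algebra, every indecomposable module `N` of finite length is the target of a right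
almost split homomorphism from a module of finite length. -/
theorem Module.exists_right_almost_split {R A N : Type u} [CommRing R] [IsArtinianRing R] [Ring A]
    [Algebra R A] [Module.Finite R A] [AddCommGroup N] [Module A N] [IsNoetherian A N]
    [IsArtinian A N] [Nontrivial N]
    (hN : ∀ p q : Submodule A N, IsCompl p q → p = ⊥ ∨ q = ⊥) :
    ∃ (E : ModuleCat.{u} A) (p : E →ₗ[A] N), IsFiniteLength A E ∧ (¬ ∃ s, p ∘ₗ s = .id) ∧
      ∀ (L : Type u) [AddCommGroup L] [Module A L] (h : L →ₗ[A] N), (¬ ∃ s, h ∘ₗ s = .id) →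
        ∃ t, p ∘ₗ t = h := by
  let _ : Module R N := Module.compHom N (algebraMap R A)
  have : IsScalarTower R A N := ⟨fun c x l ↦ by rw [Algebra.smul_def, mul_smul]; rfl⟩
  have : IsNoetherianRing A := isNoetherian_of_tower R inferInstance
  obtain ⟨I, φ, hI, hfin, hφ, hφu⟩ :=
    Module.End.exists_functional_eq_zero_of_not_isUnit (R := R) hN
  obtain ⟨k, n, hn⟩ := Submodule.fg_iff_exists_fin_generating_family.1
    (Module.Finite.fg_top (R := A) (M := N))
  obtain ⟨m, r, hr⟩ := Submodule.fg_iff_exists_fin_generating_family.1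
    (IsNoetherian.noetherian (LinearMap.ker (Fintype.linearCombination A n)))
  obtain ⟨E, p, hp⟩ := LinearMap.exists_factors_iff_forall_eq_zero hn hr φ
  have hD : IsFiniteLength A (CoinducedModule R A I) := by
    obtain ⟨_, _⟩ := isFiniteLength_iff_isNoetherian_isArtinian.1 hfin
    have h1 : IsNoetherian R (CoinducedModule R A I) := ‹IsNoetherian R (A →ₗ[R] I)›
    have h2 : IsArtinian R (CoinducedModule R A I) := ‹IsArtinian R (A →ₗ[R] I)›
    exact isFiniteLength_iff_isNoetherian_isArtinian.2
      ⟨isNoetherian_of_tower R h1, isArtinian_of_tower R h2⟩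
  obtain ⟨_, _⟩ := isFiniteLength_iff_isNoetherian_isArtinian.1 hD
  refine ⟨ModuleCat.of A E, p,
    isFiniteLength_iff_isNoetherian_isArtinian.2 ⟨?_, ?_⟩, fun hs ↦ hφ ?_, fun L _ _ h hh ↦ ?_⟩
  · exact inferInstanceAs (IsNoetherian A E)
  · exact inferInstanceAs (IsArtinian A E)
  · ext f
    exact (hp N .id).1 hs f
  · refine (hp L h).2 fun s ↦ hφu _ fun hu ↦ hh ?_
    obtain ⟨w, hw⟩ := hu
    refine ⟨s ∘ₗ (↑w⁻¹ : Module.End A N), ?_⟩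
    have := w.mul_inv
    rw [hw] at this
    exact this

/-- The commutative artinian ground ring of an Artin algebra `A` can be chosen in the universe
of `A`. -/
theorem Algebra.exists_isArtinianRing_module_finite (R : Type v) (A : Type u) [CommRing R]
    [IsArtinianRing R] [Ring A] [Algebra R A] [Module.Finite R A] :
    ∃ (R' : Type u) (_ : CommRing R') (_ : Algebra R' A),
      IsArtinianRing R' ∧ Module.Finite R' A := by
  -- The image of `R` in the center of `A` lives in the universe of `A`, is artinian as a quotient
  -- of `R`, and `A` stays finite over it.
  let R' := (Algebra.ofId R (Subalgebra.center R A)).range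
  have : IsArtinianRing R' :=
    (Algebra.ofId R (Subalgebra.center R A)).rangeRestrict_surjective.isArtinianRing
      (f := ((Algebra.ofId R (Subalgebra.center R A)).rangeRestrict : R →+* R'))
  let _ : Algebra R' A :=
    ((Subalgebra.center R A).val.comp R'.val).toRingHom.toAlgebra' fun c x ↦
      (Subalgebra.mem_center_iff.1 c.1.2 x).symm
  have : IsScalarTower R R' A := .of_algebraMap_eq fun _ ↦ rfl
  exact ⟨R', inferInstance, inferInstance, ‹_›, .of_restrictScalars_finite R R' A⟩

/-- In an indecomposable object of the category of modules, complementary submodules are trivial. -/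
theorem ModuleCat.eq_bot_or_eq_bot_of_indecomposable {A : Type u} [Ring A] {N : ModuleCat.{u} A}
    (hN : Indecomposable N) (p q : Submodule A N) (hpq : IsCompl p q) : p = ⊥ ∨ q = ⊥ := by
  have e : N ≅ ModuleCat.of A p ⊞ ModuleCat.of A q :=
    (Submodule.prodEquivOfIsCompl p q hpq).symm.toModuleIso ≪≫
      (ModuleCat.biprodIsoProd (ModuleCat.of A p) (ModuleCat.of A q)).symm
  refine (hN.2 _ _ e).imp (fun h ↦ ?_) (fun h ↦ ?_) <;>
  · have := ModuleCat.subsingleton_of_isZero h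
    exact (Submodule.subsingleton_iff_eq_bot).1 this

theorem ModuleCat.isSplitEpi_iff {A : Type u} [Ring A] {M N : ModuleCat.{u} A} (g : M ⟶ N) :
    IsSplitEpi g ↔ ∃ s, g.hom ∘ₗ s = LinearMap.id := by
  constructor
  · rintro ⟨⟨s, hs⟩⟩
    exact ⟨s.hom, congrArg ModuleCat.Hom.hom hs⟩
  · rintro ⟨s, hs⟩
    exact .mk' ⟨ModuleCat.ofHom s, ModuleCat.hom_ext hs⟩

/-- For an Artin algebra `Λ`, every indecomposable object of `mod Λ` is the target of a right almost
split morphism in `mod Λ`. -/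
theorem exists_isRightAlmostSplit_finMod {R : Type v} [CommRing R] [IsArtinianRing R]
    {Λ : Type u} [Ring Λ] [Algebra R Λ] [Module.Finite R Λ]
    (N : RightMod Λ) (hN : finMod Λ N) (hNi : Indecomposable N) :
    ∃ (E : RightMod Λ) (p : E ⟶ N), IsRightAlmostSplit (finMod Λ) p := by
  obtain ⟨R', _, _, _, _⟩ := Algebra.exists_isArtinianRing_module_finite R Λᵐᵒᵖ
  obtain ⟨_, _⟩ := isFiniteLength_iff_isNoetherian_isArtinian.1 hN
  have : Nontrivial N := by
    rw [← not_subsingleton_iff_nontrivial, ← ModuleCat.isZero_iff_subsingleton]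
    exact hNi.1
  obtain ⟨E, p, hE, hp, hfac⟩ := Module.exists_right_almost_split (R := R')
    (ModuleCat.eq_bot_or_eq_bot_of_indecomposable hNi)
  refine ⟨E, ModuleCat.ofHom p, hE, hN, by rwa [ModuleCat.isSplitEpi_iff], fun L _ h hh ↦ ?_⟩
  rw [ModuleCat.isSplitEpi_iff] at hh
  obtain ⟨t, ht⟩ := hfac L h.hom hh
  exact ⟨ModuleCat.ofHom t, ModuleCat.hom_ext ht⟩

/-- If a right almost split morphism in a bigger subcategory has a source with a right
`𝓧`-approximation, then its target, if in `𝓧`, has a right almost split morphism in `𝓧`. -/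
theorem IsRightAlmostSplit.comp_isRightApproximation {C : Type u} [Category.{v} C]
    {𝓧 𝓨 : ObjectProperty C} (hle : 𝓧 ≤ 𝓨) {X E N : C} {p : E ⟶ N} (hp : IsRightAlmostSplit 𝓨 p)
    (hN : 𝓧 N) {f : X ⟶ E} (hf : IsRightApproximation 𝓧 f) : IsRightAlmostSplit 𝓧 (f ≫ p) where
  source_mem := hf.1
  target_mem := hN
  not_isSplitEpi h := hp.not_isSplitEpi (.mk' ⟨section_ (f ≫ p) ≫ f, by simp⟩)
  factors L hL h hh := by
    obtain ⟨t, rfl⟩ := hp.factors L (hle L hL) h hh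
    obtain ⟨s, rfl⟩ := hf.2 L hL t
    exact ⟨s, by simp⟩

end Existence

theorem mainTheorem8 {R : Type v} [CommRing R] [IsArtinianRing R]
    {Λ : Type u} [Ring Λ] [Algebra R Λ] [Module.Finite R Λ]
    (d : ℕ) (hd : 1 ≤ d)
    (𝓜 : ObjectProperty (RightMod Λ)) (h𝓜 : IsClusterTilting d 𝓜)
    (N : RightMod Λ) (hN : 𝓜 N) (hNi : Indecomposable N) :
    ∃ (M : RightMod Λ) (g : M ⟶ N), IsRightAlmostSplit 𝓜 g := by
  obtain ⟨E, p, hp⟩ := exists_isRightAlmostSplit_finMod (R := R) N (h𝓜.le_finMod N hN) hNi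
  obtain ⟨M, f, hf⟩ := h𝓜.contravariantlyFinite E hp.source_mem
  exact ⟨M, f ≫ p, hp.comp_isRightApproximation h𝓜.le_finMod hN hf⟩
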